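/- Let $X$ be a non-zero Dedekind complete (real) vector lattice, and let $\mathcal{L}^r(X)$ be the Dedekind complete vector lattice of regular operators on $X$, i.e. differences of two positive linear operators $X\to X$, ordered by $S\le T$ iff $T-S$ is positive. Let $\mathcal{Z}(X)=\{T\in\mathcal{L}^r(X): \pm T\le \lambda\,\mathrm{id}_X \text{ for some }\lambda>0\}$ be the center of $X$, and let $\mathcal{D}\colon \mathcal{L}^r(X)\to\mathcal{L}^r(X)$ be the diagonal projection, i.e. the band projection onto the band generated by $\mathcal{Z}(X)$ (equivalently, by $\mathrm{id}_X$). If $P\colon X\to X$ is a positive linear projection ($P^2=P$) with constant diagonal $\alpha\in\mathbb{R}$, that is, $\mathcal{D}(P)=\alpha\,\mathrm{id}_X$, then either $\alpha=0$ or $\alpha=1/n$ for some integer $n\ge 1$. -/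

import Mathlib

/-! ### Disjointness and band projections in Dedekind complete lattice-ordered groups

A Dedekind complete vector lattice is a real vector space `X` with
`[ConditionallyCompleteLattice X] [AddCommGroup X] [IsOrderedAddMonoid X]
[Module ℝ X] [IsOrderedModule ℝ X]`. -/

namespace VectorLattice

section Band

variable {E : Type*}

/-- The disjoint complement `Aᵈ = {x : |x| ⊓ |a| = 0 for all a ∈ A}`. -/
def disjointCompl [Lattice E] [AddCommGroup E] (A : Set E) : Set E :=
  {x | ∀ a ∈ A, |x| ⊓ |a| = 0}

theorem inf_add_eq_zero [Lattice E] [AddCommGroup E] [IsOrderedAddMonoid E] {u b c : E}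
    (hu : 0 ≤ u) (hb : 0 ≤ b) (hc : 0 ≤ c) (h1 : u ⊓ b = 0) (h2 : u ⊓ c = 0) :
    u ⊓ (b + c) = 0 := by
  apply le_antisymm _ (le_inf hu (add_nonneg hb hc))
  have h3 : u ⊓ (b + c) - c ≤ u ⊓ b :=
    le_inf (sub_le_iff_le_add.2 (inf_le_left.trans (le_add_of_nonneg_right hc)))
      (sub_le_iff_le_add.2 inf_le_right)
  rw [h1, sub_nonpos] at h3
  exact h2 ▸ le_inf inf_le_left h3

theorem disjointCompl_of_le [Lattice E] [AddCommGroup E] [IsOrderedAddMonoid E] {A : Set E}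
    {x y : E} (hy : y ∈ disjointCompl A) (h : |x| ≤ |y|) : x ∈ disjointCompl A := fun a ha =>
  le_antisymm ((inf_le_inf_right _ h).trans (hy a ha).le) (le_inf (abs_nonneg _) (abs_nonneg _))

theorem disjointCompl_sub [Lattice E] [AddCommGroup E] [IsOrderedAddMonoid E] {A : Set E}
    {x y : E} (hx : x ∈ disjointCompl A) (hy : y ∈ disjointCompl A) :
    x - y ∈ disjointCompl A := by
  intro a ha
  apply le_antisymm _ (le_inf (abs_nonneg _) (abs_nonneg _))
  have h : |x - y| ≤ |x| + |y| := by
    rw [sub_eq_add_neg, ← abs_neg y]; exact abs_add_le x (-y)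
  calc |x - y| ⊓ |a| ≤ (|x| + |y|) ⊓ |a| := inf_le_inf_right _ h
    _ = 0 := by
      rw [inf_comm]
      exact inf_add_eq_zero (abs_nonneg _) (abs_nonneg _) (abs_nonneg _)
        (by rw [inf_comm]; exact hx a ha) (by rw [inf_comm]; exact hy a ha)

theorem disjointCompl_add [Lattice E] [AddCommGroup E] [IsOrderedAddMonoid E] {A : Set E}
    {x y : E} (hx : x ∈ disjointCompl A) (hy : y ∈ disjointCompl A) :
    x + y ∈ disjointCompl A := by
  rw [← sub_neg_eq_add]
  exact disjointCompl_sub hx (disjointCompl_of_le hy (abs_neg y).le)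

theorem subset_disjointCompl_disjointCompl [Lattice E] [AddCommGroup E] (A : Set E) :
    A ⊆ disjointCompl (disjointCompl A) := fun a ha x hx => by
  rw [inf_comm]; exact hx a ha

/-- Riesz decomposition `E = Aᵈᵈ ⊕ Aᵈ`, existence for positive elements. -/
theorem exists_band_decomp_of_nonneg [ConditionallyCompleteLattice E] [AddCommGroup E]
    [IsOrderedAddMonoid E] (A : Set E) {t : E} (ht : 0 ≤ t) :
    ∃ s ∈ disjointCompl (disjointCompl A), t - s ∈ disjointCompl A := by
  let W : Set E := {r | r ∈ disjointCompl (disjointCompl A) ∧ 0 ≤ r ∧ r ≤ t}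
  have h0 : (0 : E) ∈ W := ⟨fun u _ => by simp, le_rfl, ht⟩
  have hlub : IsLUB W (sSup W) := isLUB_csSup ⟨0, h0⟩ ⟨t, fun r hr => hr.2.2⟩
  have hs0 : 0 ≤ sSup W := hlub.1 h0
  have hst : sSup W ≤ t := hlub.2 fun r hr => hr.2.2
  refine ⟨sSup W, fun u hu => ?_, fun a ha => ?_⟩
  · rw [abs_of_nonneg hs0]
    have hw0 : 0 ≤ sSup W ⊓ |u| := le_inf hs0 (abs_nonneg _)
    refine le_antisymm ?_ hw0
    have : sSup W ≤ sSup W - sSup W ⊓ |u| := hlub.2 fun r hr => by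
      have hd : r ⊓ (sSup W ⊓ |u|) = 0 := by
        apply le_antisymm _ (le_inf hr.2.1 hw0)
        have := hr.1 u hu
        rw [abs_of_nonneg hr.2.1] at this
        exact this ▸ inf_le_inf_left _ inf_le_right
      rw [le_sub_iff_add_le, ← inf_add_sup r, hd, zero_add]
      exact sup_le (hlub.1 hr) inf_le_left
    simpa using this
  · rw [abs_of_nonneg (sub_nonneg.2 hst)]
    have hw0 : 0 ≤ (t - sSup W) ⊓ |a| := le_inf (sub_nonneg.2 hst) (abs_nonneg _)
    refine le_antisymm ?_ hw0
    have hw : (t - sSup W) ⊓ |a| ∈ disjointCompl (disjointCompl A) :=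
      disjointCompl_of_le (subset_disjointCompl_disjointCompl A ha)
        (by rw [abs_of_nonneg hw0]; exact inf_le_right)
    have : sSup W ≤ sSup W - (t - sSup W) ⊓ |a| := hlub.2 fun r hr => by
      rw [le_sub_iff_add_le]
      refine hlub.1 ⟨disjointCompl_add hr.1 hw, add_nonneg hr.2.1 hw0, ?_⟩
      calc r + (t - sSup W) ⊓ |a| ≤ sSup W + (t - sSup W) := add_le_add (hlub.1 hr) inf_le_left
        _ = t := by abel
    simpa using this

theorem existsUnique_band_decomp [ConditionallyCompleteLattice E] [AddCommGroup E]
    [IsOrderedAddMonoid E] (A : Set E) (t : E) :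
    ∃! s, s ∈ disjointCompl (disjointCompl A) ∧ t - s ∈ disjointCompl A := by
  obtain ⟨s₁, h₁, h₁'⟩ := exists_band_decomp_of_nonneg A (posPart_nonneg t)
  obtain ⟨s₂, h₂, h₂'⟩ := exists_band_decomp_of_nonneg A (negPart_nonneg t)
  refine ⟨s₁ - s₂, ⟨disjointCompl_sub h₁ h₂, ?_⟩, ?_⟩
  · have : t - (s₁ - s₂) = (t⁺ - s₁) - (t⁻ - s₂) := by
      nth_rw 1 [← posPart_sub_negPart t]; abel
    rw [this]
    exact disjointCompl_sub h₁' h₂'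
  · rintro s ⟨hs, hs'⟩
    have e1 : s - (s₁ - s₂) ∈ disjointCompl (disjointCompl A) :=
      disjointCompl_sub hs (disjointCompl_sub h₁ h₂)
    have e2 : s - (s₁ - s₂) ∈ disjointCompl A := by
      have : s - (s₁ - s₂) = ((t⁺ - s₁) - (t⁻ - s₂)) - (t - s) := by
        nth_rw 3 [← posPart_sub_negPart t]; abel
      rw [this]
      exact disjointCompl_sub (disjointCompl_sub h₁' h₂') hs'
    have := e1 _ e2
    rw [inf_idem] at this
    exact sub_eq_zero.1 (le_antisymm (this ▸ le_abs_self _)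
      (neg_nonpos.1 (this ▸ neg_le_abs (s - (s₁ - s₂)))))

/-- The band projection of a Dedekind complete `E` onto the band generated by a set `A` (which is
the double disjoint complement `Aᵈᵈ`, as `E` is Archimedean): `t` is sent to the unique
`s ∈ Aᵈᵈ` with `t - s ∈ Aᵈ`. -/
noncomputable def bandProjection [ConditionallyCompleteLattice E] [AddCommGroup E]
    [IsOrderedAddMonoid E] (A : Set E) (t : E) : E :=
  Classical.choose (existsUnique_band_decomp A t)

theorem bandProjection_spec [ConditionallyCompleteLattice E] [AddCommGroup E]
    [IsOrderedAddMonoid E] (A : Set E) (t : E) :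
    bandProjection A t ∈ disjointCompl (disjointCompl A) ∧
      t - bandProjection A t ∈ disjointCompl A :=
  (Classical.choose_spec (existsUnique_band_decomp A t)).1

end Band

/-! ### Regular operators -/

/-- A linear operator is positive if it maps positive elements to positive elements. -/
def IsPositiveOperator {X : Type*} [Lattice X] [AddCommGroup X] [Module ℝ X]
    (T : X →ₗ[ℝ] X) : Prop :=
  ∀ x, 0 ≤ x → 0 ≤ T x

/-- The space of regular operators, i.e. differences of two positive operators. -/
def regularOperators (X : Type*) [Lattice X] [AddCommGroup X] [IsOrderedAddMonoid X]
    [Module ℝ X] [IsOrderedModule ℝ X] : Submodule ℝ (X →ₗ[ℝ] X) where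
  carrier := {T | ∃ P Q : X →ₗ[ℝ] X, IsPositiveOperator P ∧ IsPositiveOperator Q ∧ T = P - Q}
  zero_mem' := ⟨0, 0, fun _ _ => le_rfl, fun _ _ => le_rfl, by simp⟩
  add_mem' := by
    rintro _ _ ⟨P, Q, hP, hQ, rfl⟩ ⟨P', Q', hP', hQ', rfl⟩
    exact ⟨P + P', Q + Q', fun x hx => add_nonneg (hP x hx) (hP' x hx),
      fun x hx => add_nonneg (hQ x hx) (hQ' x hx), by abel⟩
  smul_mem' := by
    rintro c _ ⟨P, Q, hP, hQ, rfl⟩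
    rcases le_total 0 c with hc | hc
    · exact ⟨c • P, c • Q, fun x hx => smul_nonneg hc (hP x hx),
        fun x hx => smul_nonneg hc (hQ x hx), smul_sub _ _ _⟩
    · refine ⟨(-c) • Q, (-c) • P, fun x hx => smul_nonneg (neg_nonneg.2 hc) (hQ x hx),
        fun x hx => smul_nonneg (neg_nonneg.2 hc) (hP x hx), ?_⟩
      rw [smul_sub, neg_smul, neg_smul]; abel

/-- `Lʳ(X)`: the type of regular operators on `X`. -/
def RegularOperator (X : Type*) [Lattice X] [AddCommGroup X] [IsOrderedAddMonoid X]
    [Module ℝ X] [IsOrderedModule ℝ X] : Type _ :=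
  ↥(regularOperators X)

namespace RegularOperator

section Order

variable {X : Type*} [Lattice X] [AddCommGroup X] [IsOrderedAddMonoid X]
  [Module ℝ X] [IsOrderedModule ℝ X]

instance : AddCommGroup (RegularOperator X) :=
  inferInstanceAs (AddCommGroup ↥(regularOperators X))

instance : Module ℝ (RegularOperator X) :=
  inferInstanceAs (Module ℝ ↥(regularOperators X))

/-- The underlying linear map. -/
def toLin (T : RegularOperator X) : X →ₗ[ℝ] X := Subtype.val T

theorem toLin_injective : Function.Injective (toLin : RegularOperator X → X →ₗ[ℝ] X) :=
  Subtype.val_injective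

@[simp] theorem toLin_add (S T : RegularOperator X) : (S + T).toLin = S.toLin + T.toLin := rfl
@[simp] theorem toLin_sub (S T : RegularOperator X) : (S - T).toLin = S.toLin - T.toLin := rfl
@[simp] theorem toLin_neg (T : RegularOperator X) : (-T).toLin = -T.toLin := rfl
@[simp] theorem toLin_zero : (0 : RegularOperator X).toLin = 0 := rfl
@[simp] theorem toLin_smul (c : ℝ) (T : RegularOperator X) : (c • T).toLin = c • T.toLin := rfl

/-- A positive operator, as a regular operator. -/
def ofPositive (T : X →ₗ[ℝ] X) (hT : IsPositiveOperator T) : RegularOperator X :=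
  ⟨T, T, 0, hT, fun _ _ => le_rfl, (sub_zero T).symm⟩

@[simp] theorem toLin_ofPositive (T : X →ₗ[ℝ] X) (hT : IsPositiveOperator T) :
    (ofPositive T hT).toLin = T := rfl

/-- The identity operator. -/
def identity (X : Type*) [Lattice X] [AddCommGroup X] [IsOrderedAddMonoid X]
    [Module ℝ X] [IsOrderedModule ℝ X] : RegularOperator X :=
  ofPositive LinearMap.id fun _ hx => hx

/-- The operator order: `S ≤ T` iff `T - S` is positive. -/
instance : PartialOrder (RegularOperator X) where
  le S T := ∀ x, 0 ≤ x → S.toLin x ≤ T.toLin x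
  le_refl _ _ _ := le_rfl
  le_trans _ _ _ h h' x hx := (h x hx).trans (h' x hx)
  le_antisymm S T h h' := by
    have key : ∀ x, 0 ≤ x → S.toLin x = T.toLin x := fun x hx => le_antisymm (h x hx) (h' x hx)
    apply toLin_injective
    ext x
    rw [← posPart_sub_negPart x, map_sub, map_sub, key _ (posPart_nonneg x),
      key _ (negPart_nonneg x)]

theorem le_def {S T : RegularOperator X} : S ≤ T ↔ ∀ x, 0 ≤ x → S.toLin x ≤ T.toLin x := Iff.rfl

instance : IsOrderedAddMonoid (RegularOperator X) where
  add_le_add_left _ _ h _ x hx := add_le_add_left (h x hx) _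

instance : IsOrderedModule ℝ (RegularOperator X) where
  smul_le_smul_of_nonneg_left _ hc _ _ h x hx := smul_le_smul_of_nonneg_left (h x hx) hc
  smul_le_smul_of_nonneg_right _ hT _ _ h x hx := smul_le_smul_of_nonneg_right h (hT x hx)

end Order

/-! The Riesz–Kantorovich theorem: over a Dedekind complete `X`, every non-empty set of regular
operators that is bounded above has a supremum. -/

section RieszKantorovich

/-- `SumValue A x a` holds if `a = ∑ Tᵢ xᵢ` for some finite decomposition `x = ∑ xᵢ` into positive
elements and some `Tᵢ ∈ A`. -/
inductive SumValue {X : Type*} [Lattice X] [AddCommGroup X] [IsOrderedAddMonoid X]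
    [Module ℝ X] [IsOrderedModule ℝ X] (A : Set (RegularOperator X)) : X → X → Prop
  | single (T : RegularOperator X) (hT : T ∈ A) (x : X) (hx : 0 ≤ x) : SumValue A x (T.toLin x)
  | add (x y a b : X) (hx : SumValue A x a) (hy : SumValue A y b) : SumValue A (x + y) (a + b)

section

variable {X : Type*} [Lattice X] [AddCommGroup X] [IsOrderedAddMonoid X]
  [Module ℝ X] [IsOrderedModule ℝ X] {A : Set (RegularOperator X)}

theorem SumValue.nonneg {x a : X} (h : SumValue A x a) : 0 ≤ x := by
  induction h with
  | single T hT x hx => exact hx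
  | add x y a b _ _ ihx ihy => exact add_nonneg ihx ihy

theorem SumValue.le {U : RegularOperator X} (hU : U ∈ upperBounds A) {x a : X}
    (h : SumValue A x a) : a ≤ U.toLin x := by
  induction h with
  | single T hT x hx => exact hU hT x hx
  | add x y a b _ _ ihx ihy => rw [map_add]; exact add_le_add ihx ihy

theorem SumValue.smul {c : ℝ} (hc : 0 ≤ c) {x a : X} (h : SumValue A x a) :
    SumValue A (c • x) (c • a) := by
  induction h with
  | single T hT x hx => rw [← map_smul]; exact .single T hT _ (smul_nonneg hc hx)
  | add x y a b _ _ ihx ihy => rw [smul_add, smul_add]; exact .add _ _ _ _ ihx ihy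

theorem SumValue.split {z a : X} (h : SumValue A z a) :
    ∀ x y : X, 0 ≤ x → 0 ≤ y → z = x + y →
      ∃ b c, SumValue A x b ∧ SumValue A y c ∧ a = b + c := by
  induction h with
  | single T hT z hz =>
    rintro x y hx hy rfl
    exact ⟨_, _, .single T hT x hx, .single T hT y hy, map_add _ _ _⟩
  | add z₁ z₂ a₁ a₂ h₁ h₂ ih₁ ih₂ =>
    intro x y hx hy hxy
    have hz₁ := h₁.nonneg
    have hz₂ := h₂.nonneg
    obtain ⟨b₁, c₁, hb₁, hc₁, rfl⟩ := ih₁ (z₁ ⊓ x) (z₁ - z₁ ⊓ x) (le_inf hz₁ hx)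
      (sub_nonneg.2 inf_le_left) (by abel)
    have hle : x - z₂ ≤ z₁ ⊓ x := by
      refine le_inf ?_ (sub_le_self _ hz₂)
      rw [sub_le_iff_le_add, hxy]
      exact le_add_of_nonneg_right hy
    obtain ⟨b₂, c₂, hb₂, hc₂, rfl⟩ := ih₂ (x - z₁ ⊓ x) (z₂ - (x - z₁ ⊓ x))
      (sub_nonneg.2 inf_le_right) (sub_nonneg.2 (sub_le_comm.1 hle)) (by abel)
    refine ⟨b₁ + b₂, c₁ + c₂, ?_, ?_, by abel⟩
    · have := SumValue.add _ _ _ _ hb₁ hb₂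
      rwa [add_sub_cancel] at this
    · have := SumValue.add _ _ _ _ hc₁ hc₂
      have e : z₁ - z₁ ⊓ x + (z₂ - (x - z₁ ⊓ x)) = y := by
        rw [← add_sub_cancel_left x y, ← hxy]; abel
      rwa [e] at this

end

variable {X : Type*} [ConditionallyCompleteLattice X] [AddCommGroup X] [IsOrderedAddMonoid X]
  [Module ℝ X] [IsOrderedModule ℝ X]

theorem exists_linear_extension (p : X → X)
    (hadd : ∀ x y, 0 ≤ x → 0 ≤ y → p (x + y) = p x + p y)
    (hsmul : ∀ (c : ℝ) x, 0 ≤ c → 0 ≤ x → p (c • x) = c • p x) :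
    ∃ F : X →ₗ[ℝ] X, ∀ x, 0 ≤ x → F x = p x := by
  have key : ∀ u v, 0 ≤ u → 0 ≤ v → p (u - v)⁺ - p (u - v)⁻ = p u - p v := by
    intro u v hu hv
    have e : (u - v)⁺ + v = u + (u - v)⁻ := by
      have := posPart_sub_negPart (u - v)
      rw [sub_eq_sub_iff_add_eq_add] at this
      exact this
    have := congrArg p e
    rw [hadd _ _ (posPart_nonneg _) hv, hadd _ _ hu (negPart_nonneg _)] at this
    rw [sub_eq_sub_iff_add_eq_add]
    exact this
  have hp0 : p 0 = 0 := by simpa using hsmul 0 0 le_rfl le_rfl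
  refine ⟨{ toFun := fun x => p x⁺ - p x⁻, map_add' := fun x y => ?_, map_smul' := fun c x => ?_ },
    fun x hx => ?_⟩
  · have h := key (x⁺ + y⁺) (x⁻ + y⁻) (add_nonneg (posPart_nonneg _) (posPart_nonneg _))
      (add_nonneg (negPart_nonneg _) (negPart_nonneg _))
    have e : x⁺ + y⁺ - (x⁻ + y⁻) = x + y := by
      nth_rw 3 [← posPart_sub_negPart x, ← posPart_sub_negPart y]; abel
    rw [e, hadd _ _ (posPart_nonneg _) (posPart_nonneg _),
      hadd _ _ (negPart_nonneg _) (negPart_nonneg _)] at h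
    rw [h]; abel
  · simp only [RingHom.id_apply]
    rcases le_total 0 c with hc | hc
    · have h := key (c • x⁺) (c • x⁻) (smul_nonneg hc (posPart_nonneg _))
        (smul_nonneg hc (negPart_nonneg _))
      rw [← smul_sub, posPart_sub_negPart, hsmul _ _ hc (posPart_nonneg _),
        hsmul _ _ hc (negPart_nonneg _)] at h
      rw [h, smul_sub]
    · have hc' : 0 ≤ -c := neg_nonneg.2 hc
      have h := key ((-c) • x⁻) ((-c) • x⁺) (smul_nonneg hc' (negPart_nonneg _))
        (smul_nonneg hc' (posPart_nonneg _))
      have e : (-c) • x⁻ - (-c) • x⁺ = c • x := by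
        nth_rw 3 [← posPart_sub_negPart x]
        rw [smul_sub, neg_smul, neg_smul]; abel
      rw [e, hsmul _ _ hc' (posPart_nonneg _), hsmul _ _ hc' (negPart_nonneg _)] at h
      rw [h, smul_sub, neg_smul, neg_smul]; abel
  · simp [posPart_of_nonneg hx, negPart_of_nonneg hx, hp0]

theorem exists_isLUB (A : Set (RegularOperator X)) (hne : A.Nonempty) (hbdd : BddAbove A) :
    ∃ S, IsLUB A S := by
  obtain ⟨T₀, hT₀⟩ := hne
  obtain ⟨U, hU⟩ := hbdd
  let p : X → X := fun x => sSup {a | SumValue A x a}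
  have hp : ∀ x, 0 ≤ x → IsLUB {a | SumValue A x a} (p x) := fun x hx =>
    isLUB_csSup ⟨_, .single T₀ hT₀ x hx⟩ ⟨U.toLin x, fun a ha => SumValue.le hU ha⟩
  have hadd : ∀ x y, 0 ≤ x → 0 ≤ y → p (x + y) = p x + p y := by
    intro x y hx hy
    apply le_antisymm
    · refine (hp _ (add_nonneg hx hy)).2 fun a ha => ?_
      obtain ⟨b, c, hb, hc, rfl⟩ := SumValue.split ha x y hx hy rfl
      exact add_le_add ((hp x hx).1 hb) ((hp y hy).1 hc)
    · rw [← le_sub_iff_add_le]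
      refine (hp x hx).2 fun b hb => ?_
      rw [le_sub_comm]
      refine (hp y hy).2 fun c hc => ?_
      rw [le_sub_iff_add_le, add_comm]
      exact (hp _ (add_nonneg hx hy)).1 (.add _ _ _ _ hb hc)
  have hsmul_le : ∀ (c : ℝ) x, 0 ≤ c → 0 ≤ x → c • p x ≤ p (c • x) := by
    intro c x hc hx
    rcases hc.eq_or_lt with rfl | hc'
    · have h : SumValue A 0 (T₀.toLin 0) := .single T₀ hT₀ 0 le_rfl
      rw [map_zero] at h
      simpa using (hp 0 le_rfl).1 h
    · have : p x ≤ c⁻¹ • p (c • x) := (hp x hx).2 fun a ha => by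
        have h := smul_le_smul_of_nonneg_left
          ((hp _ (smul_nonneg hc hx)).1 (SumValue.smul hc ha)) (inv_nonneg.2 hc)
        rwa [inv_smul_smul₀ hc'.ne'] at h
      have h := smul_le_smul_of_nonneg_left this hc
      rwa [smul_inv_smul₀ hc'.ne'] at h
  have hsmul : ∀ (c : ℝ) x, 0 ≤ c → 0 ≤ x → p (c • x) = c • p x := by
    intro c x hc hx
    refine le_antisymm ?_ (hsmul_le c x hc hx)
    rcases hc.eq_or_lt with rfl | hc'
    · rw [zero_smul, zero_smul]
      refine (hp 0 le_rfl).2 fun a ha => ?_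
      simpa using SumValue.le hU ha
    · have h := smul_le_smul_of_nonneg_left
        (hsmul_le c⁻¹ (c • x) (inv_nonneg.2 hc) (smul_nonneg hc hx)) hc
      rwa [smul_inv_smul₀ hc'.ne', inv_smul_smul₀ hc'.ne'] at h
  obtain ⟨F, hF⟩ := exists_linear_extension p hadd hsmul
  have hpos : IsPositiveOperator (F - T₀.toLin) := fun x hx => by
    rw [LinearMap.sub_apply, hF x hx, sub_nonneg]
    exact (hp x hx).1 (.single T₀ hT₀ x hx)
  have hG : (ofPositive _ hpos + T₀).toLin = F := by simp
  refine ⟨ofPositive _ hpos + T₀, fun T hT x hx => ?_, fun V hV x hx => ?_⟩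
  · rw [hG, hF x hx]
    exact (hp x hx).1 (.single T hT x hx)
  · rw [hG, hF x hx]
    exact (hp x hx).2 fun a ha => SumValue.le hV ha

theorem exists_isLUB_pair (S T : RegularOperator X) : ∃ R, IsLUB {S, T} R := by
  refine exists_isLUB _ ⟨S, by simp⟩ ?_
  obtain ⟨P, Q, hP, hQ, hS⟩ := S.2
  obtain ⟨P', Q', hP', hQ', hT⟩ := T.2
  have hS' : S.toLin = P - Q := hS
  have hT' : T.toLin = P' - Q' := hT
  refine ⟨ofPositive P hP + ofPositive P' hP', ?_⟩
  rintro R (rfl | rfl) x hx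
  · simp only [hS', toLin_add, toLin_ofPositive, LinearMap.sub_apply, LinearMap.add_apply]
    exact (sub_le_self _ (hQ x hx)).trans (le_add_of_nonneg_right (hP' x hx))
  · simp only [hT', toLin_add, toLin_ofPositive, LinearMap.sub_apply, LinearMap.add_apply]
    exact (sub_le_self _ (hQ' x hx)).trans (le_add_of_nonneg_left (hP x hx))

theorem isGLB_of_isLUB_neg {A : Set (RegularOperator X)} {S : RegularOperator X}
    (h : IsLUB (Neg.neg '' A) S) : IsGLB A (-S) :=
  ⟨fun _ hT => neg_le.1 (h.1 ⟨_, hT, rfl⟩), fun V hV => le_neg.1 (h.2 (by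
    rintro _ ⟨T, hT, rfl⟩
    exact neg_le_neg (hV hT)))⟩

theorem exists_isGLB (A : Set (RegularOperator X)) (hne : A.Nonempty) (hbdd : BddBelow A) :
    ∃ S, IsGLB A S := by
  obtain ⟨L, hL⟩ := hbdd
  obtain ⟨S, hS⟩ := exists_isLUB (Neg.neg '' A) (hne.image _) ⟨-L, by
    rintro _ ⟨T, hT, rfl⟩
    exact neg_le_neg (hL hT)⟩
  exact ⟨-S, isGLB_of_isLUB_neg hS⟩

theorem exists_isGLB_pair (S T : RegularOperator X) : ∃ R, IsGLB {S, T} R := by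
  obtain ⟨R, hR⟩ := exists_isLUB_pair (-S) (-T)
  refine ⟨-R, isGLB_of_isLUB_neg ?_⟩
  rwa [Set.image_pair]

open Classical in
/-- `Lʳ(X)` is a Dedekind complete vector lattice; the lattice operations are determined by the
operator order. -/
noncomputable instance : ConditionallyCompleteLattice (RegularOperator X) where
  sup S T := choose (exists_isLUB_pair S T)
  le_sup_left S T := (choose_spec (exists_isLUB_pair S T)).1 (by simp)
  le_sup_right S T := (choose_spec (exists_isLUB_pair S T)).1 (by simp)
  sup_le S T R h h' := (choose_spec (exists_isLUB_pair S T)).2 (by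
    rintro _ (rfl | rfl) <;> assumption)
  inf S T := choose (exists_isGLB_pair S T)
  inf_le_left S T := (choose_spec (exists_isGLB_pair S T)).1 (by simp)
  inf_le_right S T := (choose_spec (exists_isGLB_pair S T)).1 (by simp)
  le_inf R S T h h' := (choose_spec (exists_isGLB_pair S T)).2 (by
    rintro _ (rfl | rfl) <;> assumption)
  sSup A := if h : ∃ S, IsLUB A S then choose h else 0
  sInf A := if h : ∃ S, IsGLB A S then choose h else 0
  isLUB_csSup A hne hb := by
    have h := exists_isLUB A hne hb
    rw [dif_pos h]
    exact choose_spec h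
  isGLB_csInf A hne hb := by
    have h := exists_isGLB A hne hb
    rw [dif_pos h]
    exact choose_spec h

end RieszKantorovich

end RegularOperator

/-! ### The diagonal projection -/

/-- The center of `X`: the operators `T` with `±T ≤ r • id` for some real `r > 0` (such operators
are automatically regular). -/
def center (X : Type*) [Lattice X] [AddCommGroup X] [IsOrderedAddMonoid X]
    [Module ℝ X] [IsOrderedModule ℝ X] : Set (RegularOperator X) :=
  {T | ∃ r : ℝ, 0 < r ∧ T ≤ r • RegularOperator.identity X ∧ -T ≤ r • RegularOperator.identity X}

/-- The diagonal projection `𝒟 : Lʳ(X) → Lʳ(X)`: the band projection onto the band generated by the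
center of `X`, i.e. onto the band generated by the identity. (When `X` is a Banach lattice, this
band is the center itself.) -/
noncomputable def diagonalProjection {X : Type*} [ConditionallyCompleteLattice X] [AddCommGroup X]
    [IsOrderedAddMonoid X] [Module ℝ X] [IsOrderedModule ℝ X] (T : RegularOperator X) :
    RegularOperator X :=
  bandProjection (center X) T

/-- `T` has constant diagonal `α` if `𝒟(T) = α • id`. -/
def HasConstantDiagonal {X : Type*} [ConditionallyCompleteLattice X] [AddCommGroup X]
    [IsOrderedAddMonoid X] [Module ℝ X] [IsOrderedModule ℝ X] (T : RegularOperator X) (α : ℝ) :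
    Prop :=
  diagonalProjection T = α • RegularOperator.identity X

end VectorLattice

/-! Assume `α > 0`. Then `P ≥ α • id`, so `P` kills no non-zero positive element and its range is a
sublattice. The remainder `T = P - α • id` is disjoint from `id`, and the Riesz–Kantorovich formula
for `T ⊓ id` finds, below each `c > 0`, a non-zero component `b` of `c` with `P b ≤ (α + ε) • b` on
the band of `b` (`exists_component_posPart_inf_eq_zero`). Elements of the range disjoint from `b`
are disjoint from `P b` (`inf_map_eq_zero`), so `P b` lies between `α • w'` and `(α + ε) • w'` for a
fixed element `w'` above `b` (`exists_range_component`).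

Collecting `k` disjoint such pieces inside a fixed `w`, which may shrink on the way, gives a
component `s` of `w` with `(k * α) • w ≤ P s ≤ (k * (α + ε)) • w`. Since `P s ≤ w`, `k * α ≤ 1`, so
the collection stops; it can only stop at `s = w`, where `1 ≤ k * (α + ε)`. As `ε → 0`, this makes
`1 / α` an integer. -/

namespace VectorLattice

/-! ### Disjointness and scalar multiples -/

section Disjoint

theorem inf_eq_zero_mono {X : Type*} [Lattice X] [AddCommGroup X] {u u' v v' : X} (h : u ⊓ v = 0) (hu : 0 ≤ u') (hv : 0 ≤ v')
    (hu' : u' ≤ u) (hv' : v' ≤ v) : u' ⊓ v' = 0 :=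
  le_antisymm (h ▸ inf_le_inf hu' hv') (le_inf hu hv)

theorem le_inv_smul {X : Type*} [Lattice X] [AddCommGroup X] [Module ℝ X] [IsOrderedModule ℝ X]
    {x y : X} {c : ℝ} (hc : 0 < c) (h : c • x ≤ y) : x ≤ c⁻¹ • y := by
  simpa [inv_smul_smul₀ hc.ne'] using smul_le_smul_of_nonneg_left h (inv_nonneg.2 hc.le)

theorem IsPositiveOperator.mono {X : Type*} [Lattice X] [AddCommGroup X] [IsOrderedAddMonoid X]
    [Module ℝ X] {P : X →ₗ[ℝ] X} (hpos : IsPositiveOperator P) {x y : X} (h : x ≤ y) :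
    P x ≤ P y := by
  have := hpos _ (sub_nonneg.2 h)
  rwa [map_sub, sub_nonneg] at this

variable {X : Type*} [Lattice X] [AddCommGroup X] [IsOrderedAddMonoid X]

/-- Both `x` and `z` dominate `x - y`. This is the tool for restricting an inequality to a band:
error terms disjoint from the left side drop out. -/
theorem le_of_le_add_of_inf_eq_zero {x y z : X} (hy : 0 ≤ y) (h : x ≤ y + z)
    (hd : x ⊓ z = 0) : x ≤ y := by
  rw [← sub_nonpos, ← hd]
  exact le_inf (sub_le_self _ hy) (sub_le_iff_le_add'.2 h)

theorem add_le_of_inf_eq_zero {x y z : X} (hx : x ≤ z) (hy : y ≤ z) (hd : x ⊓ y = 0) :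
    x + y ≤ z := by
  rw [← inf_add_sup x y, hd, zero_add]
  exact sup_le hx hy

theorem posPart_sub_inf_posPart_sub (x y : X) : (x - y)⁺ ⊓ (y - x)⁺ = 0 := by
  rw [← neg_sub x y, posPart_neg]
  exact posPart_inf_negPart_eq_zero _

variable [Module ℝ X] [IsOrderedModule ℝ X]

/-- The factor `1 + c` is at least both `1` and `c`, so `u ⊓ c • v` is below `(1 + c) • u` and `(1 +
c) • v`. -/
theorem inf_smul_eq_zero {u v : X} {c : ℝ} (hc : 0 ≤ c) (hu : 0 ≤ u) (hv : 0 ≤ v)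
    (h : u ⊓ v = 0) : u ⊓ c • v = 0 := by
  have hc1 : (0 : ℝ) < 1 + c := by linarith
  have hcv : 0 ≤ c • v := smul_nonneg hc hv
  refine le_antisymm ?_ (le_inf hu hcv)
  have h1 : (1 + c)⁻¹ • (u ⊓ c • v) ≤ u ⊓ v := by
    apply le_inf
    · have : u ⊓ c • v ≤ (1 + c) • u := by
        rw [add_smul, one_smul]
        exact inf_le_left.trans (le_add_of_nonneg_right (smul_nonneg hc hu))
      simpa [inv_smul_smul₀ hc1.ne'] using smul_le_smul_of_nonneg_left this (inv_nonneg.2 hc1.le)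
    · have : u ⊓ c • v ≤ (1 + c) • v := by
        rw [add_smul, one_smul]
        exact inf_le_right.trans (le_add_of_nonneg_left hv)
      simpa [inv_smul_smul₀ hc1.ne'] using smul_le_smul_of_nonneg_left this (inv_nonneg.2 hc1.le)
  rw [h] at h1
  simpa [smul_inv_smul₀ hc1.ne'] using smul_le_smul_of_nonneg_left h1 hc1.le

theorem le_of_smul_le_smul_right {a b : ℝ} {w : X} (hw : 0 ≤ w) (hw0 : w ≠ 0)
    (h : a • w ≤ b • w) : a ≤ b := by
  by_contra! hab
  have hab' : 0 < a - b := sub_pos.2 hab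
  have h1 : (a - b) • w ≤ 0 := by rw [sub_smul]; exact sub_nonpos.2 h
  have h2 := smul_le_smul_of_nonneg_left h1 (inv_nonneg.2 hab'.le)
  rw [inv_smul_smul₀ hab'.ne', smul_zero] at h2
  exact hw0 (le_antisymm h2 hw)

end Disjoint

/-! ### Components and operators disjoint from the identity -/

section DedekindComplete

variable {X : Type*} [ConditionallyCompleteLattice X] [AddCommGroup X] [IsOrderedAddMonoid X]

/-- The Archimedean property: the supremum `σ` of the multiples of `z` satisfies `σ ≤ σ - z`. -/
theorem nonpos_of_forall_nsmul_le {z w : X} (h : ∀ n : ℕ, n • z ≤ w) : z ≤ 0 := by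
  have hlub : IsLUB (Set.range fun n : ℕ => n • z) (sSup (Set.range fun n : ℕ => n • z)) :=
    isLUB_csSup ⟨_, 0, rfl⟩ ⟨w, by rintro _ ⟨n, rfl⟩; exact h n⟩
  have : sSup (Set.range fun n : ℕ => n • z) ≤ sSup (Set.range fun n : ℕ => n • z) - z :=
    hlub.2 (by
      rintro _ ⟨n, rfl⟩
      rw [le_sub_iff_add_le]
      exact hlub.1 ⟨n + 1, succ_nsmul z n⟩)
  simpa using this

/-- The component of `c` in the band generated by `d`. -/
theorem exists_component {c d : X} (hc : 0 ≤ c) (hd : 0 ≤ d) :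
    ∃ b, 0 ≤ b ∧ b ≤ c ∧ b ⊓ (c - b) = 0 ∧ (c - b) ⊓ d = 0 ∧
      ∀ v, 0 ≤ v → v ⊓ d = 0 → b ⊓ v = 0 := by
  obtain ⟨b, hb, hb'⟩ := exists_band_decomp_of_nonneg {d} hc
  have h1 : |b| ⊓ |c - b| = 0 := hb _ hb'
  have hb0 : 0 ≤ b := by
    rw [← negPart_eq_zero]
    refine le_antisymm ?_ (negPart_nonneg b)
    rw [← h1]
    refine le_inf (sup_le (neg_le_abs b) (abs_nonneg b)) (sup_le ?_ (abs_nonneg _))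
    refine le_trans ?_ (le_abs_self _)
    rw [sub_eq_add_neg]
    exact le_add_of_nonneg_left hc
  have hcb : 0 ≤ c - b := by
    rw [← negPart_eq_zero]
    refine le_antisymm ?_ (negPart_nonneg _)
    rw [← h1]
    refine le_inf (sup_le (le_trans ?_ (le_abs_self b)) (abs_nonneg b))
      (sup_le (neg_le_abs _) (abs_nonneg _))
    rw [neg_sub]
    exact sub_le_self _ hc
  refine ⟨b, hb0, sub_nonneg.1 hcb, ?_, ?_, fun v hv hvd => ?_⟩
  · rwa [abs_of_nonneg hb0, abs_of_nonneg hcb] at h1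
  · have := hb' d rfl
    rwa [abs_of_nonneg hcb, abs_of_nonneg hd] at this
  · have := hb v (by
      rintro _ rfl
      rwa [abs_of_nonneg hv, abs_of_nonneg hd])
    rwa [abs_of_nonneg hb0, abs_of_nonneg hv] at this

variable [Module ℝ X] [IsOrderedModule ℝ X]

/-- The Riesz–Kantorovich formula for `T ⊓ id = 0`: the elements `T y + (c - y)`, `0 ≤ y ≤ c`, have
no lower bound other than the negative elements. -/
theorem nonpos_of_forall_le_of_inf_identity_eq_zero {T : RegularOperator X} (hT : 0 ≤ T)
    (h : T ⊓ RegularOperator.identity X = 0) {c z : X} (hc : 0 ≤ c)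
    (hz : ∀ y, 0 ≤ y → y ≤ c → z ≤ T.toLin y + (c - y)) : z ≤ 0 := by
  have hT0 : ∀ x, 0 ≤ x → 0 ≤ T.toLin x := fun x hx => hT x hx
  let V : X → Set X := fun x => {a | ∃ y, 0 ≤ y ∧ y ≤ x ∧ a = T.toLin y + (x - y)}
  have hV : ∀ x, 0 ≤ x → IsGLB (V x) (sInf (V x)) := fun x hx =>
    isGLB_csInf ⟨_, 0, le_rfl, hx, rfl⟩ ⟨0, by
      rintro _ ⟨y, hy, hyx, rfl⟩
      exact add_nonneg (hT0 y hy) (sub_nonneg.2 hyx)⟩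
  have hV0 : ∀ x, 0 ≤ x → 0 ≤ sInf (V x) := fun x hx => (hV x hx).2 (by
    rintro _ ⟨y, hy, hyx, rfl⟩
    exact add_nonneg (hT0 y hy) (sub_nonneg.2 hyx))
  have hadd : ∀ x y, 0 ≤ x → 0 ≤ y → sInf (V (x + y)) = sInf (V x) + sInf (V y) := by
    intro x y hx hy
    apply le_antisymm
    · rw [← sub_le_iff_le_add]
      refine (hV x hx).2 ?_
      rintro _ ⟨u, hu, hux, rfl⟩
      rw [sub_le_comm]
      refine (hV y hy).2 ?_
      rintro _ ⟨v, hv, hvy, rfl⟩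
      rw [sub_le_iff_le_add]
      refine (hV _ (add_nonneg hx hy)).1 ⟨u + v, add_nonneg hu hv, add_le_add hux hvy, ?_⟩
      rw [map_add]; abel
    · refine (hV _ (add_nonneg hx hy)).2 ?_
      rintro _ ⟨u, hu, hux, rfl⟩
      have h1 : u - u ⊓ x ≤ y := by
        rw [sub_le_iff_le_add, ← sub_le_iff_le_add']
        exact le_inf (sub_le_self _ hy) (sub_le_iff_le_add.2 hux)
      calc sInf (V x) + sInf (V y)
          ≤ (T.toLin (u ⊓ x) + (x - u ⊓ x)) + (T.toLin (u - u ⊓ x) + (y - (u - u ⊓ x))) :=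
            add_le_add ((hV x hx).1 ⟨_, le_inf hu hx, inf_le_right, rfl⟩)
              ((hV y hy).1 ⟨_, sub_nonneg.2 inf_le_left, h1, rfl⟩)
        _ = T.toLin u + (x + y - u) := by rw [map_sub]; abel
  have hsmul_le : ∀ (r : ℝ) x, 0 < r → 0 ≤ x → r • sInf (V x) ≤ sInf (V (r • x)) := by
    intro r x hr hx
    refine (hV _ (smul_nonneg hr.le hx)).2 ?_
    rintro _ ⟨u, hu, hux, rfl⟩
    have hmem : sInf (V x) ≤ T.toLin (r⁻¹ • u) + (x - r⁻¹ • u) := by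
      refine (hV x hx).1 ⟨_, smul_nonneg (inv_nonneg.2 hr.le) hu, ?_, rfl⟩
      simpa [inv_smul_smul₀ hr.ne'] using smul_le_smul_of_nonneg_left hux (inv_nonneg.2 hr.le)
    have := smul_le_smul_of_nonneg_left hmem hr.le
    rwa [smul_add, smul_sub, ← map_smul, smul_inv_smul₀ hr.ne'] at this
  have hsmul : ∀ (r : ℝ) x, 0 ≤ r → 0 ≤ x → sInf (V (r • x)) = r • sInf (V x) := by
    intro r x hr hx
    rcases hr.eq_or_lt with rfl | hr
    · have := hadd 0 0 le_rfl le_rfl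
      rw [add_zero, left_eq_add] at this
      rw [zero_smul, zero_smul, this]
    · refine le_antisymm ?_ (hsmul_le r x hr hx)
      have := hsmul_le r⁻¹ (r • x) (inv_pos.2 hr) (smul_nonneg hr.le hx)
      have := smul_le_smul_of_nonneg_left this hr.le
      rwa [smul_inv_smul₀ hr.ne', inv_smul_smul₀ hr.ne'] at this
  -- The infima extend to a positive operator below both `T` (take `y = x`) and `id` (take `y = 0`),
  -- hence below `T ⊓ id = 0`.
  obtain ⟨F, hF⟩ := RegularOperator.exists_linear_extension (fun x => sInf (V x)) hadd hsmul
  have hFpos : IsPositiveOperator F := fun x hx => by rw [hF x hx]; exact hV0 x hx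
  have hle : RegularOperator.ofPositive F hFpos ≤ T ⊓ RegularOperator.identity X := by
    refine le_inf (fun x hx => ?_) (fun x hx => ?_)
    · rw [RegularOperator.toLin_ofPositive, hF x hx]
      exact (hV x hx).1 ⟨x, hx, le_rfl, by simp⟩
    · rw [RegularOperator.toLin_ofPositive, hF x hx]
      exact (hV x hx).1 ⟨0, le_rfl, hx, by rw [map_zero, zero_add, sub_zero]; rfl⟩
  rw [h] at hle
  have h0 := hle c hc
  rw [RegularOperator.toLin_ofPositive, hF c hc] at h0
  refine le_trans ((hV c hc).2 ?_) h0
  rintro _ ⟨y, hy, hyc, rfl⟩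
  exact hz y hy hyc

/-- If `T ⊓ id = 0` then every non-zero `c ≥ 0` has a non-zero component `b` such that `T b ≤ ε • b`
holds on the band generated by `b`. -/
theorem exists_component_posPart_inf_eq_zero {T : RegularOperator X} (hT : 0 ≤ T)
    (h : T ⊓ RegularOperator.identity X = 0) {c : X} (hc : 0 ≤ c) (hc0 : c ≠ 0) {ε : ℝ}
    (hε : 0 < ε) :
    ∃ b, 0 ≤ b ∧ b ≠ 0 ∧ b ≤ c ∧ b ⊓ (c - b) = 0 ∧ (T.toLin b - ε • b)⁺ ⊓ b = 0 := by
  have hε1 : (0 : ℝ) < 1 + ε := by linarith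
  have hT0 : ∀ x, 0 ≤ x → 0 ≤ T.toLin x := fun x hx => hT x hx
  -- Otherwise `(ε / (1 + ε)) • c` would be a non-zero positive lower bound of all `T y + (c - y)`.
  obtain ⟨y, hy, hyc, hny⟩ : ∃ y, 0 ≤ y ∧ y ≤ c ∧ ¬ ε • c ≤ (1 + ε) • (T.toLin y + (c - y)) := by
    by_contra! hcon
    have h1 : (1 + ε)⁻¹ • ε • c ≤ 0 :=
      nonpos_of_forall_le_of_inf_identity_eq_zero hT h hc fun y hy hyc => by
        simpa [inv_smul_smul₀ hε1.ne'] using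
          smul_le_smul_of_nonneg_left (hcon y hy hyc) (inv_nonneg.2 hε1.le)
    have h2 : ((1 + ε)⁻¹ * ε) • c ≤ (0 : ℝ) • c := by rwa [mul_smul, zero_smul]
    have h3 := le_of_smul_le_smul_right hc hc0 h2
    have : 0 < (1 + ε)⁻¹ * ε := by positivity
    linarith
  set u := T.toLin y + (c - y) with hu
  have hu0 : 0 ≤ u := add_nonneg (hT0 y hy) (sub_nonneg.2 hyc)
  -- On the band of `d`, `(1 + ε) • u ≤ ε • c`. There the summand `c - y` of `u` forces `c ≤ (1 + ε)
  -- • y`, and the summand `T y` gives `(1 + ε) • T y ≤ ε • c`; together these bound `T b` by `ε •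
  -- b`.
  set d := (ε • c - (1 + ε) • u)⁺ with hd
  have hd0 : 0 ≤ d := posPart_nonneg _
  have hdc : d ≤ ε • c :=
    sup_le (sub_le_self _ (smul_nonneg hε1.le hu0)) (smul_nonneg hε.le hc)
  have hdne : d ≠ 0 := fun h0 => hny (sub_nonpos.1 (posPart_eq_zero.1 h0))
  obtain ⟨b, hb, hbc, hbd, hcd, hband⟩ := exists_component hc hd0
  have hb1 : b ⊓ ((1 + ε) • u - ε • c)⁺ = 0 :=
    hband _ (posPart_nonneg _) (posPart_sub_inf_posPart_sub _ _)
  have hcb : 0 ≤ c - b := sub_nonneg.2 hbc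
  have hdisj : b ⊓ (((1 + ε) • u - ε • c)⁺ + ε • (c - b)) = 0 :=
    inf_add_eq_zero hb (posPart_nonneg _) (smul_nonneg hε.le hcb) hb1
      (inf_smul_eq_zero hε.le hb hcb hbd)
  have hule : (1 + ε) • u ≤ ε • b + (((1 + ε) • u - ε • c)⁺ + ε • (c - b)) := by
    have := le_posPart ((1 + ε) • u - ε • c)
    calc (1 + ε) • u = ε • b + (((1 + ε) • u - ε • c) + ε • (c - b)) := by rw [smul_sub]; abel
      _ ≤ _ := by gcongr
  have hby : b ≤ (1 + ε) • y := by
    have h1 : b ≤ (1 + ε) • y + (((1 + ε) • u - ε • c)⁺ + ε • (c - b)) := by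
      have h2 : (1 + ε) • (c - y) ≤ (1 + ε) • u :=
        smul_le_smul_of_nonneg_left (le_add_of_nonneg_left (hT0 y hy)) hε1.le
      have h3 := h2.trans hule
      have h4 : (1 + ε) • b ≤ (1 + ε) • c := smul_le_smul_of_nonneg_left hbc hε1.le
      have h5 := h4.trans_eq (show (1 + ε) • c = (1 + ε) • (c - y) + (1 + ε) • y by
        rw [smul_sub]; abel)
      have h6 := h5.trans (add_le_add_left h3 _)
      rw [add_smul, one_smul] at h6
      rw [← add_le_add_iff_left (ε • b)]
      calc ε • b + b = b + ε • b := add_comm _ _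
        _ ≤ _ := h6
        _ = _ := by abel
    exact le_of_le_add_of_inf_eq_zero (smul_nonneg hε1.le hy) h1 hdisj
  refine ⟨b, hb, ?_, hbc, hbd, ?_⟩
  -- If `b = 0`, then `c` is disjoint from `d`; but `d ≤ ε • c`, so `d = 0`.
  · rintro rfl
    rw [sub_zero] at hcd
    have := inf_smul_eq_zero hε.le hd0 hc (by rwa [inf_comm])
    rw [inf_eq_left.2 hdc] at this
    exact hdne this
  · rw [inf_comm]
    refine inf_eq_zero_mono hdisj hb (posPart_nonneg _) le_rfl (sup_le ?_ ?_)
    · rw [sub_le_iff_le_add']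
      refine le_trans ?_ hule
      refine (IsPositiveOperator.mono hT0 hby).trans ?_
      rw [map_smul]
      exact smul_le_smul_of_nonneg_left (le_add_of_nonneg_right (sub_nonneg.2 hyc)) hε1.le
    · exact add_nonneg (posPart_nonneg _) (smul_nonneg hε.le hcb)

end DedekindComplete

/-! ### The range of a positive projection dominating `α • id` -/

section Projection

variable {X : Type*} [ConditionallyCompleteLattice X] [AddCommGroup X] [IsOrderedAddMonoid X]
  [Module ℝ X] [IsOrderedModule ℝ X] {P : X →ₗ[ℝ] X} {α : ℝ}

/-- The range of a positive projection that dominates a positive multiple of the identity is a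
sublattice. -/
theorem map_sup_eq_of_map_eq (hpos : IsPositiveOperator P) (hproj : ∀ x, P (P x) = P x)
    (hα : 0 < α) (hle : ∀ x, 0 ≤ x → α • x ≤ P x) {x y : X} (hx : P x = x) (hy : P y = y) :
    P (x ⊔ y) = x ⊔ y := by
  have h1 : x ⊔ y ≤ P (x ⊔ y) :=
    sup_le (hx.ge.trans (hpos.mono le_sup_left)) (hy.ge.trans (hpos.mono le_sup_right))
  -- The positive element `P (x ⊔ y) - x ⊔ y` is killed by `P`, which dominates `α • id`.
  have h2 := le_inv_smul hα (hle _ (sub_nonneg.2 h1))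
  rw [map_sub, hproj, sub_self, smul_zero, sub_nonpos] at h2
  exact le_antisymm h2 h1

theorem map_inf_eq_of_map_eq (hpos : IsPositiveOperator P) (hproj : ∀ x, P (P x) = P x)
    (hα : 0 < α) (hle : ∀ x, 0 ≤ x → α • x ≤ P x) {x y : X} (hx : P x = x) (hy : P y = y) :
    P (x ⊓ y) = x ⊓ y := by
  have h : x ⊓ y = x + y - x ⊔ y := eq_sub_of_add_eq (inf_add_sup x y)
  rw [h, map_sub, map_add, hx, hy, map_sup_eq_of_map_eq hpos hproj hα hle hx hy]

theorem map_posPart_eq_of_map_eq (hpos : IsPositiveOperator P) (hproj : ∀ x, P (P x) = P x)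
    (hα : 0 < α) (hle : ∀ x, 0 ≤ x → α • x ≤ P x) {x : X} (hx : P x = x) :
    P x⁺ = x⁺ :=
  map_sup_eq_of_map_eq hpos hproj hα hle hx (map_zero P)

/-- An element of the range that is disjoint from `b` is disjoint from `P b`. -/
theorem inf_map_eq_zero (hpos : IsPositiveOperator P) (hproj : ∀ x, P (P x) = P x)
    (hα : 0 < α) (hle : ∀ x, 0 ≤ x → α • x ≤ P x) {r b : X} (hr : 0 ≤ r) (hrP : P r = r)
    (hb : 0 ≤ b) (hd : r ⊓ b = 0) : r ⊓ P b = 0 := by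
  set w := α⁻¹ • P b with hw
  have hPb : 0 ≤ P b := hpos b hb
  have hw0 : 0 ≤ w := smul_nonneg (inv_nonneg.2 hα.le) hPb
  have hwP : P w = w := by rw [hw, map_smul, hproj]
  have hbw : b ≤ w := le_inv_smul hα (hle b hb)
  -- Archimedean argument: every `n • (r ⊓ P b)` is below `w`.
  refine le_antisymm (nonpos_of_forall_nsmul_le (w := w) fun n => ?_) (le_inf hr hPb)
  have hnr : 0 ≤ (n : ℝ) • r := smul_nonneg n.cast_nonneg hr
  -- The disjoint elements `b` and `n • r ⊓ w` have sum below `w`; apply `P`, which fixes the latter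
  -- and `w`.
  have h1 : P b + (n : ℝ) • r ⊓ w ≤ w := by
    have h2 : b + (n : ℝ) • r ⊓ w ≤ w := by
      refine add_le_of_inf_eq_zero hbw inf_le_right ?_
      exact inf_eq_zero_mono (inf_smul_eq_zero n.cast_nonneg hb hr (by rwa [inf_comm])) hb
        (le_inf hnr hw0) le_rfl inf_le_left
    have h3 := hpos.mono h2
    rwa [map_add, hwP, map_inf_eq_of_map_eq hpos hproj hα hle (by rw [map_smul, hrP]) hwP] at h3
  have h2 : P b ≤ (w - (n : ℝ) • r)⁺ := by
    refine (le_sub_iff_add_le.2 h1).trans ?_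
    rw [sub_le_comm]
    exact le_inf (sub_le_comm.1 (le_posPart _)) (sub_le_self _ (posPart_nonneg _))
  -- The excess over `w` is below both `(n • r - w)⁺` and `n • (w - n • r)⁺`, which are disjoint.
  rw [← Nat.cast_smul_eq_nsmul ℝ n, ← sub_nonpos, ← posPart_eq_zero]
  have h3 : (n : ℝ) • (r ⊓ P b) ≤ (n : ℝ) • (w - (n : ℝ) • r)⁺ :=
    smul_le_smul_of_nonneg_left (inf_le_right.trans h2) n.cast_nonneg
  have h4 : ((n : ℝ) • (r ⊓ P b) - w)⁺ ≤ ((n : ℝ) • r - w)⁺ :=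
    posPart_mono (sub_le_sub_right
      (smul_le_smul_of_nonneg_left inf_le_left n.cast_nonneg) _)
  have h5 : ((n : ℝ) • (r ⊓ P b) - w)⁺ ≤ (n : ℝ) • (w - (n : ℝ) • r)⁺ :=
    sup_le ((sub_le_self _ hw0).trans h3) (smul_nonneg n.cast_nonneg (posPart_nonneg _))
  have h6 := inf_smul_eq_zero (n.cast_nonneg (α := ℝ)) (posPart_nonneg _) (posPart_nonneg _)
    (posPart_sub_inf_posPart_sub ((n : ℝ) • r) w)
  exact le_antisymm (h6 ▸ le_inf h4 h5) (posPart_nonneg _)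

/-- If `P b ≤ (α + ε) • b` on the band generated by a component `b` of `w = P w`, then
`α • w' ≤ P b ≤ (α + ε) • w'` for some component `w' = P w'` of `w` with `b ≤ w'`. -/
theorem exists_range_component (hpos : IsPositiveOperator P) (hproj : ∀ x, P (P x) = P x)
    (hα : 0 < α) (hle : ∀ x, 0 ≤ x → α • x ≤ P x) {ε : ℝ} (hε : 0 < ε) {w b : X}
    (hwP : P w = w) (hb : 0 ≤ b) (hbw : b ≤ w) (hbd : b ⊓ (w - b) = 0)
    (hPb : (P b - (α + ε) • b)⁺ ⊓ b = 0) :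
    ∃ w', P w' = w' ∧ b ≤ w' ∧ w' ≤ w ∧ w' ⊓ (w - w') = 0 ∧
      α • w' ≤ P b ∧ P b ≤ (α + ε) • w' := by
  have hw0 : 0 ≤ w := hb.trans hbw
  have hPb0 : 0 ≤ P b := hpos b hb
  have hαε : 0 < α + ε := by linarith
  -- The excess `(P b - (α + ε) • w)⁺` is fixed by `P` and disjoint from `b`, hence disjoint from `P
  -- b`, which dominates it.
  have hup : P b ≤ (α + ε) • w := by
    have hgP : P (P b - (α + ε) • w)⁺ = (P b - (α + ε) • w)⁺ :=
      map_posPart_eq_of_map_eq hpos hproj hα hle (by rw [map_sub, hproj, map_smul, hwP])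
    have hg : (P b - (α + ε) • w)⁺ ⊓ b = 0 :=
      inf_eq_zero_mono hPb (posPart_nonneg _) hb (posPart_mono (sub_le_sub_left
        (smul_le_smul_of_nonneg_left hbw hαε.le) _)) le_rfl
    have hg' := inf_map_eq_zero hpos hproj hα hle (posPart_nonneg _) hgP hb hg
    have hgle : (P b - (α + ε) • w)⁺ ≤ P b :=
      sup_le (sub_le_self _ (smul_nonneg hαε.le hw0)) hPb0
    rw [inf_eq_left.2 hgle] at hg'
    exact sub_nonpos.1 (posPart_eq_zero.1 hg')
  -- This deficit is fixed by `P` and below `α • (w - b)`, so it is disjoint from `b`.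
  have hdisj : (α • w - P b)⁺ ⊓ P b = 0 := by
    refine inf_map_eq_zero hpos hproj hα hle (posPart_nonneg _)
      (map_posPart_eq_of_map_eq hpos hproj hα hle (by rw [map_sub, hproj, map_smul, hwP])) hb ?_
    rw [inf_comm]
    refine inf_eq_zero_mono (inf_smul_eq_zero hα.le hb (sub_nonneg.2 hbw) hbd) hb
      (posPart_nonneg _) le_rfl (sup_le ?_ (smul_nonneg hα.le (sub_nonneg.2 hbw)))
    rw [smul_sub]
    exact sub_le_sub_left (hle b hb) _
  -- By `hdisj`, `w'` is the part of `w` in the band of `P b`: `w - w'` is disjoint from `P b`.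
  set w' := w ⊓ α⁻¹ • P b with hw'
  have hw'0 : 0 ≤ w' := le_inf hw0 (smul_nonneg (inv_nonneg.2 hα.le) hPb0)
  have hlow : α • w' ≤ P b := by
    have := smul_le_smul_of_nonneg_left (inf_le_right : w' ≤ α⁻¹ • P b) hα.le
    rwa [smul_inv_smul₀ hα.ne'] at this
  have hsub : w - w' ≤ α⁻¹ • (α • w - P b)⁺ := by
    rw [sub_le_comm]
    refine le_inf (sub_le_self _ (smul_nonneg (inv_nonneg.2 hα.le) (posPart_nonneg _))) ?_
    rw [sub_le_comm]
    have := smul_le_smul_of_nonneg_left (le_posPart (α • w - P b)) (inv_nonneg.2 hα.le)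
    rwa [smul_sub, inv_smul_smul₀ hα.ne'] at this
  have hww' : 0 ≤ w - w' := sub_nonneg.2 inf_le_left
  have hd1 : P b ⊓ (w - w') = 0 := by
    refine inf_eq_zero_mono (inf_smul_eq_zero (inv_nonneg.2 hα.le) hPb0 (posPart_nonneg _)
      (by rwa [inf_comm])) hPb0 hww' le_rfl hsub
  refine ⟨w', map_inf_eq_of_map_eq hpos hproj hα hle hwP (by rw [map_smul, hproj]),
    le_inf hbw (le_inv_smul hα (hle b hb)), inf_le_left, ?_, hlow, ?_⟩
  · have := inf_smul_eq_zero (inv_nonneg.2 hα.le) hww' hPb0 (by rwa [inf_comm])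
    rw [inf_comm]
    exact inf_eq_zero_mono this hww' hw'0 le_rfl inf_le_right
  · refine le_of_le_add_of_inf_eq_zero (smul_nonneg hαε.le hw'0) (hup.trans_eq ?_)
      (inf_smul_eq_zero hαε.le hPb0 hww' hd1)
    rw [smul_sub]; abel

/-! ### Collecting disjoint pieces -/

/-- `s` is a component of a non-zero `w = P w` with `k * α ≤ P s / w ≤ k * (α + ε)`. -/
structure IsApproxSum (P : X →ₗ[ℝ] X) (α ε : ℝ) (k : ℕ) (w s : X) : Prop where
  map_eq : P w = w
  ne_zero : w ≠ 0
  nonneg : 0 ≤ s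
  le : s ≤ w
  disjoint : s ⊓ (w - s) = 0
  lower : (k * α) • w ≤ P s
  upper : P s ≤ (k * (α + ε)) • w

theorem IsApproxSum.mul_le_one (hpos : IsPositiveOperator P) {ε : ℝ} {k : ℕ} {w s : X}
    (h : IsApproxSum P α ε k w s) : k * α ≤ 1 := by
  refine le_of_smul_le_smul_right (h.nonneg.trans h.le) h.ne_zero (h.lower.trans ?_)
  rw [one_smul]
  exact (hpos.mono h.le).trans_eq h.map_eq

/-- Take a piece `b` of the gap `w - s`, shrink `w` to the fixed component `w'` belonging to `b`,
and replace `s` by `s ⊓ w' + b`. As `P` fixes `w'` and `w - w'`, the bounds on `P s` restrict to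
`w'`; `P b` adds between `α • w'` and `(α + ε) • w'`. -/
theorem IsApproxSum.exists_succ (hpos : IsPositiveOperator P) (hproj : ∀ x, P (P x) = P x)
    (hα : 0 < α) (hle : ∀ x, 0 ≤ x → α • x ≤ P x) {ε : ℝ} (hε : 0 < ε)
    (hcomp : ∀ c, 0 ≤ c → c ≠ 0 →
      ∃ b, 0 ≤ b ∧ b ≠ 0 ∧ b ≤ c ∧ b ⊓ (c - b) = 0 ∧ (P b - (α + ε) • b)⁺ ⊓ b = 0)
    {k : ℕ} {w s : X} (h : IsApproxSum P α ε k w s) (hsw : s ≠ w) :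
    ∃ w' s', IsApproxSum P α ε (k + 1) w' s' := by
  have hws : 0 ≤ w - s := sub_nonneg.2 h.le
  have hs0 := h.nonneg
  have hαε : 0 < α + ε := by linarith
  obtain ⟨b, hb, hb0, hbws, hbd, hPb⟩ := hcomp (w - s) hws (sub_ne_zero.2 hsw.symm)
  have hbs : b ⊓ s = 0 := by
    rw [inf_comm]
    exact inf_eq_zero_mono h.disjoint hs0 hb le_rfl hbws
  have hbw : b ≤ w := hbws.trans (sub_le_self _ hs0)
  have hbd' : b ⊓ (w - b) = 0 := by
    have := inf_add_eq_zero hb (sub_nonneg.2 hbws) hs0 hbd hbs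
    rwa [show w - s - b + s = w - b by abel] at this
  obtain ⟨w', hw'P, hbw', hw'w, hw'd, hlow, hup⟩ :=
    exists_range_component hpos hproj hα hle hε h.map_eq hb hbw hbd' hPb
  have hw'0 : 0 ≤ w' := hb.trans hbw'
  have hww' : 0 ≤ w - w' := sub_nonneg.2 hw'w
  have ht0 : 0 ≤ s ⊓ w' := le_inf hs0 hw'0
  have hPt : P (s ⊓ w') ≤ w' := (hpos.mono inf_le_right).trans_eq hw'P
  have hrest : s - s ⊓ w' ≤ w - w' := by
    rw [sub_le_iff_le_add, ← sub_le_iff_le_add']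
    refine le_inf (sub_le_self _ hww') ?_
    rw [sub_sub_eq_add_sub, add_comm, add_sub_assoc]
    exact add_le_of_nonpos_right (sub_nonpos.2 h.le)
  have hPrest : P (s - s ⊓ w') ≤ w - w' := by
    refine (hpos.mono hrest).trans_eq ?_
    rw [map_sub, h.map_eq, hw'P]
  have hPrest0 : 0 ≤ P (s - s ⊓ w') := hpos _ (sub_nonneg.2 inf_le_left)
  have hkα : 0 ≤ k * α := by positivity
  have hkαε : 0 ≤ k * (α + ε) := by positivity
  -- The discarded part `P (s - s ⊓ w') ≤ w - w'` is disjoint from `w'`.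
  have htlow : (k * α) • w' ≤ P (s ⊓ w') := by
    refine le_of_le_add_of_inf_eq_zero (z := P (s - s ⊓ w')) (hpos _ ht0) ?_ ?_
    · rw [← map_add, add_sub_cancel]
      exact (smul_le_smul_of_nonneg_left hw'w hkα).trans h.lower
    · rw [inf_comm]
      exact inf_smul_eq_zero hkα hPrest0 hw'0
        (inf_eq_zero_mono (by rwa [inf_comm]) hPrest0 hw'0 hPrest le_rfl)
  have htup : P (s ⊓ w') ≤ (k * (α + ε)) • w' := by
    refine le_of_le_add_of_inf_eq_zero (z := (k * (α + ε)) • (w - w'))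
      (smul_nonneg hkαε hw'0) ?_ ?_
    · rw [← smul_add, add_sub_cancel]
      exact (hpos.mono inf_le_left).trans h.upper
    · exact inf_smul_eq_zero hkαε (hpos _ ht0) hww'
        (inf_eq_zero_mono hw'd (hpos _ ht0) hww' hPt le_rfl)
  have hs'w' : s ⊓ w' + b ≤ w' :=
    add_le_of_inf_eq_zero inf_le_right hbw'
      (inf_eq_zero_mono (by rwa [inf_comm]) ht0 hb inf_le_left le_rfl)
  have hc0 : 0 ≤ w' - (s ⊓ w' + b) := sub_nonneg.2 hs'w'
  -- The new gap lies inside what `b` leaves of the old one, so it is disjoint from `s` and from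
  -- `b`.
  have hc : w' - (s ⊓ w' + b) ≤ w - s - b := by
    rw [← sub_sub]
    refine sub_le_sub_right ?_ _
    rw [sub_le_iff_le_add, ← sub_le_iff_le_add']
    refine le_inf ?_ (sub_le_self _ hws)
    rw [sub_le_iff_le_add, add_sub_cancel]
    exact hw'w
  refine ⟨w', s ⊓ w' + b, hw'P, ?_, add_nonneg ht0 hb, hs'w', ?_, ?_, ?_⟩
  · rintro rfl
    exact hb0 (le_antisymm hbw' hb)
  · rw [inf_comm]
    refine inf_add_eq_zero hc0 ht0 hb ?_ ?_ <;> rw [inf_comm]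
    · exact inf_eq_zero_mono h.disjoint ht0 hc0 inf_le_left (hc.trans (sub_le_self _ hb))
    · exact inf_eq_zero_mono hbd hb hc0 le_rfl hc
  · rw [map_add, Nat.cast_succ, add_one_mul, add_smul]
    exact add_le_add htlow hlow
  · rw [map_add, Nat.cast_succ, add_one_mul, add_smul]
    exact add_le_add htup hup

theorem exists_nat_mul_le_one_le [Nontrivial X] (hpos : IsPositiveOperator P)
    (hproj : ∀ x, P (P x) = P x)
    (hα : 0 < α) (hle : ∀ x, 0 ≤ x → α • x ≤ P x) {ε : ℝ} (hε : 0 < ε)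
    (hcomp : ∀ c, 0 ≤ c → c ≠ 0 →
      ∃ b, 0 ≤ b ∧ b ≠ 0 ∧ b ≤ c ∧ b ⊓ (c - b) = 0 ∧ (P b - (α + ε) • b)⁺ ⊓ b = 0) :
    ∃ k : ℕ, k * α ≤ 1 ∧ 1 ≤ k * (α + ε) := by
  obtain ⟨x, hx⟩ := exists_ne (0 : X)
  -- `P |x|` is non-zero because it dominates `α • |x|`.
  have hstart : IsApproxSum P α ε 0 (P |x|) 0 := by
    refine ⟨hproj _, fun h0 => hx ?_, le_rfl, hpos _ (abs_nonneg x), ?_, ?_, ?_⟩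
    · have h1 := le_inv_smul hα (hle _ (abs_nonneg x))
      rw [h0, smul_zero] at h1
      exact le_antisymm ((le_abs_self x).trans h1) (neg_nonpos.1 ((neg_le_abs x).trans h1))
    · simpa using hpos _ (abs_nonneg x)
    · simp
    · simp
  by_contra! hcon
  have hall : ∀ k : ℕ, ∃ w s, IsApproxSum P α ε k w s := by
    intro k
    induction k with
    | zero => exact ⟨_, _, hstart⟩
    | succ k ih =>
      obtain ⟨w, s, h⟩ := ih
      refine h.exists_succ hpos hproj hα hle hε hcomp ?_
      -- If `s = w`, then `w = P w ≤ (k * (α + ε)) • w`, which gives `1 ≤ k * (α + ε)`.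
      rintro rfl
      refine (hcon k (h.mul_le_one hpos)).not_ge
        (le_of_smul_le_smul_right h.nonneg h.ne_zero ?_)
      rw [one_smul]
      exact h.map_eq.ge.trans h.upper
  obtain ⟨k, hk⟩ := exists_nat_gt (1 / α)
  obtain ⟨w, s, h⟩ := hall k
  have := h.mul_le_one hpos
  rw [div_lt_iff₀ hα] at hk
  linarith

end Projection

/-! ### The limit `ε → 0` -/

theorem exists_eq_one_div_of_forall {α : ℝ} (hα : 0 < α)
    (h : ∀ ε > 0, ∃ k : ℕ, k * α ≤ 1 ∧ 1 ≤ k * (α + ε)) :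
    ∃ n : ℕ, 0 < n ∧ α = 1 / (n : ℝ) := by
  have hfloor : ⌊1 / α⌋₊ * α ≤ 1 := by
    rw [← le_div_iff₀ hα]
    exact Nat.floor_le (by positivity)
  have hge : 1 ≤ ⌊1 / α⌋₊ * α := by
    refine le_of_forall_pos_le_add fun δ hδ => ?_
    -- With `ε = δ * α` the error `k * ε = (k * α) * δ` is at most `δ`, and `k ≤ ⌊1 / α⌋₊` whatever
    -- `δ` is.
    obtain ⟨k, hk, hk'⟩ := h (δ * α) (by positivity)
    have hkn : (k : ℝ) ≤ ⌊1 / α⌋₊ := by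
      exact_mod_cast Nat.le_floor ((le_div_iff₀ hα).2 hk)
    have h1 : k * α * δ ≤ δ := mul_le_of_le_one_left hδ.le hk
    have h2 : k * α ≤ ⌊1 / α⌋₊ * α := mul_le_mul_of_nonneg_right hkn hα.le
    nlinarith
  have heq : (⌊1 / α⌋₊ : ℝ) * α = 1 := le_antisymm hfloor hge
  refine ⟨⌊1 / α⌋₊, Nat.pos_of_ne_zero fun h0 => ?_, ?_⟩
  · rw [h0] at heq
    simp at heq
  · exact eq_one_div_of_mul_eq_one_right heq

/-! ### Consequences of a constant diagonal -/

section Diagonal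

variable {X : Type*} [ConditionallyCompleteLattice X] [AddCommGroup X] [IsOrderedAddMonoid X]
  [Module ℝ X] [IsOrderedModule ℝ X]

theorem RegularOperator.identity_nonneg : 0 ≤ RegularOperator.identity X := fun _ hx => hx

theorem identity_mem_center : RegularOperator.identity X ∈ center X := by
  refine ⟨1, one_pos, (one_smul ℝ _).ge, ?_⟩
  rw [one_smul]
  exact (neg_nonpos.2 RegularOperator.identity_nonneg).trans RegularOperator.identity_nonneg

theorem HasConstantDiagonal.abs_inf_identity_eq_zero {T : RegularOperator X} {α : ℝ}
    (h : HasConstantDiagonal T α) :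
    |T - α • RegularOperator.identity X| ⊓ RegularOperator.identity X = 0 := by
  have h1 := (bandProjection_spec (center X) T).2 _ identity_mem_center
  rw [abs_of_nonneg RegularOperator.identity_nonneg] at h1
  rw [HasConstantDiagonal, diagonalProjection] at h
  rwa [h] at h1

/-- The diagonal part of a positive operator is dominated by the operator. -/
theorem HasConstantDiagonal.smul_identity_le {T : RegularOperator X} {α : ℝ}
    (h : HasConstantDiagonal T α) (hT : 0 ≤ T) : α • RegularOperator.identity X ≤ T := by
  have hI : 0 ≤ RegularOperator.identity X := RegularOperator.identity_nonneg
  rw [← sub_nonpos, ← posPart_eq_zero]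
  -- `(α • id - T)⁺` is below both `|T - α • id|` and `|α| • id`, which are disjoint.
  have h1 := inf_smul_eq_zero (abs_nonneg α) (abs_nonneg _) hI h.abs_inf_identity_eq_zero
  refine le_antisymm ?_ (posPart_nonneg _)
  rw [← h1]
  refine sup_le (le_inf ?_ ?_) (le_inf (abs_nonneg _) (smul_nonneg (abs_nonneg _) hI))
  · rw [abs_sub_comm]; exact le_abs_self _
  · exact (sub_le_self _ hT).trans (smul_le_smul_of_nonneg_right (le_abs_self α) hI)

/-- If `α < 0`, then `(-α) • id ≤ T - α • id`, so `(-α) • id` is below an operator disjoint from it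
and vanishes. -/
theorem HasConstantDiagonal.nonneg [Nontrivial X] {T : RegularOperator X} {α : ℝ}
    (h : HasConstantDiagonal T α) (hT : 0 ≤ T) : 0 ≤ α := by
  have hI : 0 ≤ RegularOperator.identity X := RegularOperator.identity_nonneg
  by_contra! hα
  have h1 := inf_smul_eq_zero (neg_nonneg.2 hα.le) (abs_nonneg _) hI h.abs_inf_identity_eq_zero
  have h2 : (-α) • RegularOperator.identity X ≤ |T - α • RegularOperator.identity X| := by
    refine le_trans ?_ (le_abs_self _)
    rw [neg_smul, sub_eq_add_neg]
    exact le_add_of_nonneg_left hT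
  rw [inf_eq_right.2 h2] at h1
  obtain ⟨x, hx⟩ := exists_ne (0 : X)
  have h3 : (-α) • x = 0 := congrArg (fun S => S.toLin x) h1
  exact hx ((smul_eq_zero.1 h3).resolve_left (neg_pos.2 hα).ne')

theorem HasConstantDiagonal.eq_zero_or_eq_one_div [Nontrivial X] {P : X →ₗ[ℝ] X}
    (hpos : IsPositiveOperator P) (hproj : ∀ x, P (P x) = P x) {α : ℝ}
    (hdiag : HasConstantDiagonal (RegularOperator.ofPositive P hpos) α) :
    α = 0 ∨ ∃ n : ℕ, 0 < n ∧ α = 1 / (n : ℝ) := by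
  have hP : 0 ≤ RegularOperator.ofPositive P hpos := fun x hx => hpos x hx
  rcases (hdiag.nonneg hP).eq_or_lt with h0 | hα
  · exact Or.inl h0.symm
  have hle' := hdiag.smul_identity_le hP
  have hle : ∀ x, 0 ≤ x → α • x ≤ P x := fun x hx => hle' x hx
  have hT := sub_nonneg.2 hle'
  have hinf := hdiag.abs_inf_identity_eq_zero
  rw [abs_of_nonneg hT] at hinf
  refine Or.inr (exists_eq_one_div_of_forall hα fun ε hε =>
    exists_nat_mul_le_one_le hpos hproj hα hle hε fun c hc hc0 => ?_)
  obtain ⟨b, hb, hb0, hbc, hbd, hTb⟩ := exists_component_posPart_inf_eq_zero hT hinf hc hc0 hε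
  refine ⟨b, hb, hb0, hbc, hbd, ?_⟩
  have : P b - (α + ε) • b = P b - α • b - ε • b := by rw [add_smul]; abel
  rw [this]
  exact hTb

end Diagonal

end VectorLattice

theorem mainTheorem2 {X : Type*} [ConditionallyCompleteLattice X] [AddCommGroup X]
    [IsOrderedAddMonoid X] [Module ℝ X] [IsOrderedModule ℝ X] [Nontrivial X]
    (P : X →ₗ[ℝ] X) (hpos : VectorLattice.IsPositiveOperator P) (hproj : P ∘ₗ P = P)
    (α : ℝ)
    (hdiag : VectorLattice.HasConstantDiagonal
      (VectorLattice.RegularOperator.ofPositive P hpos) α) :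
    α = 0 ∨ ∃ n : ℕ, 0 < n ∧ α = 1 / (n : ℝ) :=
  VectorLattice.HasConstantDiagonal.eq_zero_or_eq_one_div hpos
    (fun x => LinearMap.congr_fun hproj x) hdiag
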